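/- Let $1<p,q<\infty$, $\theta>0$, and let $(c,d)\subset\mathbb R$ be a bounded open interval with Lebesgue measure. For measurable $f$ on $(c,d)$ put $$\|f\|_{p),\theta}=\sup_{0<\varepsilon\le p-1}\varepsilon^{\frac{\theta}{p-\varepsilon}}\Big(\int_c^d|f(t)|^{p-\varepsilon}\,dt\Big)^{\frac1{p-\varepsilon}},$$ and let $L^{p),\theta}(c,d)$ be the space of (classes of) $f$ with $\|f\|_{p),\theta}<\infty$. Let $Q\subset\mathbb R$ be a compact set such that for some $x\in(c,d)$ the interior of the translate $Q+x$ meets $(c,d)$. The grand Wiener amalgam space $W(L^{p),\theta},L^{q),\theta})(c,d)$ with window $Q$ consists of all (classes of) measurable $f:(c,d)\to\mathbb C$ such that $\|f\chi_K\|_{p),\theta}<\infty$ for every compact $K\subset(c,d)$ and such that the control function $F_f(x)=\|f\chi_{Q+x}\|_{p),\theta}$, $x\in(c,d)$, lies in $L^{q),\theta}(c,d)$; it carries the norm $\|f\|_W=\|F_f\|_{q),\theta}$. (If the translates $Q+x$, $x\in(c,d)$, do not see all of $(c,d)$, then $\|\cdot\|_W$ is only a seminorm, and reflexivity is understood for the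 quotient by the functions of zero seminorm.) Then $W(L^{p),\theta},L^{q),\theta})(c,d)$ is not reflexive, i.e. the canonical map into its bidual is not surjective. -/

import Mathlib

open MeasureTheory Set Filter Topology
open scoped ENNReal NNReal

noncomputable section

namespace GrandWiener

/-- The generalized grand Lebesgue norm
`‖f‖_{p),θ} = sup_{0 < ε ≤ p - 1} ε ^ (θ / (p - ε)) ‖f‖_{p - ε}`, with values in `[0, ∞]`.
The target may be `ℂ`, or `[0, ∞]` as for the control function below. -/
def grandNorm {α F : Type*} [MeasurableSpace α] [ENorm F] (p θ : ℝ) (μ : Measure α)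
    (f : α → F) : ℝ≥0∞ :=
  ⨆ ε ∈ Ioc (0 : ℝ) (p - 1),
    ENNReal.ofReal (ε ^ (θ / (p - ε))) * eLpNorm f (ENNReal.ofReal (p - ε)) μ

/-- Lebesgue measure on the interval `(c, d)`. -/
abbrev intervalMeasure (c d : ℝ) : Measure ℝ := volume.restrict (Ioo c d)

/-- The translate `Q + x`. -/
def translate (Q : TopologicalSpace.Compacts ℝ) (x : ℝ) : Set ℝ := (fun t => t + x) '' (Q : Set ℝ)

/-- The control function `F_f(x) = ‖f χ_{Q + x}‖_{p),θ}`. -/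
def controlFun (p θ : ℝ) (μ : Measure ℝ) (Q : TopologicalSpace.Compacts ℝ) (f : ℝ → ℂ) (x : ℝ) :
    ℝ≥0∞ :=
  grandNorm p θ μ ((translate Q x).indicator f)

/-- The grand Wiener amalgam norm `‖ ‖f χ_{Q + x}‖_{p),θ₁} ‖_{q),θ₂}`, with values in `[0, ∞]`. -/
def amalgamNorm (p θ₁ q θ₂ : ℝ) (μ : Measure ℝ) (Q : TopologicalSpace.Compacts ℝ) (f : ℝ → ℂ) :
    ℝ≥0∞ :=
  grandNorm q θ₂ μ (controlFun p θ₁ μ Q f)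

/-- `f ∈ (L^{p),θ})_loc` on `(c, d)`. -/
def LocGrand (p θ c d : ℝ) (f : ℝ → ℂ) : Prop :=
  ∀ K : Set ℝ, IsCompact K → K ⊆ Ioo c d →
    grandNorm p θ (intervalMeasure c d) (K.indicator f) < ∞

/-! ### The norm properties needed for the vector space and norm structure -/

section basic

variable {α F : Type*} [MeasurableSpace α] {p θ : ℝ} {μ : Measure α}

lemma grandNorm_congr_ae [ENorm F] {f g : α → F} (h : f =ᵐ[μ] g) :
    grandNorm p θ μ f = grandNorm p θ μ g := by
  simp only [grandNorm, eLpNorm_congr_ae h]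

lemma grandNorm_mono [ENorm F] {f g : α → F} (h : ∀ x, ‖f x‖ₑ ≤ ‖g x‖ₑ) :
    grandNorm p θ μ f ≤ grandNorm p θ μ g :=
  iSup₂_mono fun _ _ => mul_le_mul_right (eLpNorm_mono_enorm h) _

lemma grandNorm_add_le [TopologicalSpace F] [ESeminormedAddMonoid F] [ContinuousAdd F]
    {f g : α → F} (hf : AEStronglyMeasurable f μ) (hg : AEStronglyMeasurable g μ) :
    grandNorm p θ μ (f + g) ≤ grandNorm p θ μ f + grandNorm p θ μ g := by
  refine iSup₂_le fun ε hε => ?_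
  have h1 : (1 : ℝ≥0∞) ≤ ENNReal.ofReal (p - ε) := by
    rw [ENNReal.one_le_ofReal]; linarith [hε.2]
  refine (mul_le_mul_right (eLpNorm_add_le hf hg h1) _).trans ?_
  rw [mul_add]
  exact add_le_add
    (le_iSup₂ (f := fun ε _ => ENNReal.ofReal (ε ^ (θ / (p - ε))) *
      eLpNorm f (ENNReal.ofReal (p - ε)) μ) ε hε)
    (le_iSup₂ (f := fun ε _ => ENNReal.ofReal (ε ^ (θ / (p - ε))) *
      eLpNorm g (ENNReal.ofReal (p - ε)) μ) ε hε)

lemma eLpNorm_enorm_smul (a : ℂ) (f : α → ℝ≥0∞) {r : ℝ} (hr : 1 ≤ r) :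
    eLpNorm (fun x => ‖a‖ₑ * f x) (ENNReal.ofReal r) μ
      = ‖a‖ₑ * eLpNorm f (ENNReal.ofReal r) μ := by
  have hr0 : 0 < r := by linarith
  have h0 : ENNReal.ofReal r ≠ 0 := by simpa using hr0
  rw [eLpNorm_eq_lintegral_rpow_enorm_toReal h0 ENNReal.ofReal_ne_top,
    eLpNorm_eq_lintegral_rpow_enorm_toReal h0 ENNReal.ofReal_ne_top,
    ENNReal.toReal_ofReal hr0.le]
  simp only [enorm_eq_self, ENNReal.mul_rpow_of_nonneg _ _ hr0.le]
  rw [lintegral_const_mul' _ _ (ENNReal.rpow_ne_top_of_nonneg hr0.le enorm_ne_top),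
    ENNReal.mul_rpow_of_nonneg _ _ (by positivity), ← ENNReal.rpow_mul,
    mul_one_div_cancel hr0.ne', ENNReal.rpow_one]

lemma grandNorm_enorm_mul (a : ℂ) (f : α → ℝ≥0∞) :
    grandNorm p θ μ (fun x => ‖a‖ₑ * f x) = ‖a‖ₑ * grandNorm p θ μ f := by
  simp only [grandNorm, ENNReal.mul_iSup]
  refine iSup_congr fun ε => iSup_congr fun hε => ?_
  rw [eLpNorm_enorm_smul a f (by linarith [hε.2])]
  ring

lemma grandNorm_smul (a : ℂ) (f : α → ℂ) :
    grandNorm p θ μ (a • f) = ‖a‖ₑ * grandNorm p θ μ f := by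
  simp only [grandNorm, ENNReal.mul_iSup, eLpNorm_const_smul]
  refine iSup_congr fun ε => iSup_congr fun hε => ?_
  ring

end basic

/-- The supremum in the grand norm may be taken over a countable dense set of exponents. -/
lemma eLpNorm_le_of_seq {α : Type*} [MeasurableSpace α] {μ : Measure α} {p θ : ℝ} {f : α → ℂ}
    (hf : Measurable f) {S : ℝ≥0∞} {e : ℕ → ℝ} {ε : ℝ} (he : ∀ n, e n ∈ Ioc (0 : ℝ) (p - 1))
    (hε : ε ∈ Ioc (0 : ℝ) (p - 1)) (hlim : Tendsto e atTop (𝓝 ε))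
    (hS : ∀ n, ENNReal.ofReal (e n ^ (θ / (p - e n))) *
      eLpNorm f (ENNReal.ofReal (p - e n)) μ ≤ S) :
    ENNReal.ofReal (ε ^ (θ / (p - ε))) * eLpNorm f (ENNReal.ofReal (p - ε)) μ ≤ S := by
  rcases eq_or_ne S ∞ with rfl | hStop
  · exact le_top
  have key : ∀ ε ∈ Ioc (0 : ℝ) (p - 1),
      (ENNReal.ofReal (ε ^ (θ / (p - ε))) * eLpNorm f (ENNReal.ofReal (p - ε)) μ ≤ S ↔
        ∫⁻ t, ENNReal.ofReal (‖f t‖ ^ (p - ε)) ∂μ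
          ≤ ENNReal.ofReal ((S.toReal / ε ^ (θ / (p - ε))) ^ (p - ε))) := by
    intro ε hε
    have hr : 0 < p - ε := by linarith [hε.2]
    have hw : 0 < ε ^ (θ / (p - ε)) := Real.rpow_pos_of_pos hε.1 _
    rw [eLpNorm_eq_lintegral_rpow_enorm_toReal (by simpa using hr) ENNReal.ofReal_ne_top,
      ENNReal.toReal_ofReal hr.le, mul_comm,
      ← ENNReal.le_div_iff_mul_le (Or.inl (by simpa using hw)) (Or.inl ENNReal.ofReal_ne_top),
      one_div, ENNReal.rpow_inv_le_iff hr,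
      ← ENNReal.ofReal_rpow_of_nonneg (by positivity) hr.le,
      ENNReal.ofReal_div_of_pos hw, ENNReal.ofReal_toReal hStop]
    simp_rw [← ENNReal.ofReal_rpow_of_nonneg (norm_nonneg _) hr.le, ofReal_norm]
  rw [key ε hε]
  have hr : 0 < p - ε := by linarith [hε.2]
  have hw : 0 < ε ^ (θ / (p - ε)) := Real.rpow_pos_of_pos hε.1 _
  have hlr : Tendsto (fun n => p - e n) atTop (𝓝 (p - ε)) := hlim.const_sub p
  have hlw : Tendsto (fun n => e n ^ (θ / (p - e n))) atTop (𝓝 (ε ^ (θ / (p - ε)))) :=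
    hlim.rpow (tendsto_const_nhds.div hlr hr.ne') (Or.inl hε.1.ne')
  have hR : Tendsto (fun n => ENNReal.ofReal ((S.toReal / e n ^ (θ / (p - e n))) ^ (p - e n)))
      atTop (𝓝 (ENNReal.ofReal ((S.toReal / ε ^ (θ / (p - ε))) ^ (p - ε)))) :=
    ENNReal.tendsto_ofReal ((tendsto_const_nhds.div hlw hw.ne').rpow hlr (Or.inr hr))
  have hpt : ∀ t, Tendsto (fun n => ENNReal.ofReal (‖f t‖ ^ (p - e n))) atTop
      (𝓝 (ENNReal.ofReal (‖f t‖ ^ (p - ε)))) := fun t =>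
    ENNReal.tendsto_ofReal (tendsto_const_nhds.rpow hlr (Or.inr hr))
  calc ∫⁻ t, ENNReal.ofReal (‖f t‖ ^ (p - ε)) ∂μ
      = ∫⁻ t, liminf (fun n => ENNReal.ofReal (‖f t‖ ^ (p - e n))) atTop ∂μ :=
        lintegral_congr fun t => (hpt t).liminf_eq.symm
    _ ≤ liminf (fun n => ∫⁻ t, ENNReal.ofReal (‖f t‖ ^ (p - e n)) ∂μ) atTop :=
        lintegral_liminf_le fun n => by fun_prop
    _ ≤ liminf (fun n => ENNReal.ofReal ((S.toReal / e n ^ (θ / (p - e n))) ^ (p - e n))) atTop :=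
        liminf_le_liminf (Eventually.of_forall fun n => (key _ (he n)).1 (hS n))
    _ = _ := hR.liminf_eq

lemma exists_countable_grandNorm_eq (p θ : ℝ) : ∃ D : Set ℝ, D.Countable ∧
    ∀ {α : Type} [MeasurableSpace α] (μ : Measure α) (f : α → ℂ), Measurable f →
      grandNorm p θ μ f = ⨆ ε ∈ D,
        ENNReal.ofReal (ε ^ (θ / (p - ε))) * eLpNorm f (ENNReal.ofReal (p - ε)) μ := by
  obtain ⟨D, hDs, hDc, hDd⟩ :=
    TopologicalSpace.IsSeparable.exists_countable_dense_subset
      (TopologicalSpace.IsSeparable.of_separableSpace (Ioc (0 : ℝ) (p - 1)))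
  refine ⟨D, hDc, fun μ f hf => le_antisymm (iSup₂_le fun ε hε => ?_) ?_⟩
  · obtain ⟨e, heD, hlim⟩ := mem_closure_iff_seq_limit.1 (hDd hε)
    exact eLpNorm_le_of_seq hf (fun n => hDs (heD n)) hε hlim fun n =>
      le_iSup₂ (f := fun ε (_ : ε ∈ D) => ENNReal.ofReal (ε ^ (θ / (p - ε))) *
        eLpNorm f (ENNReal.ofReal (p - ε)) μ) (e n) (heD n)
  · exact biSup_mono fun ε hε => hDs hε

section control

variable {p θ θ₁ q θ₂ : ℝ} {μ : Measure ℝ} {Q : TopologicalSpace.Compacts ℝ}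

lemma mem_translate {x t : ℝ} : t ∈ translate Q x ↔ t - x ∈ Q := by
  simp [translate, sub_eq_add_neg]

lemma measurableSet_translate (x : ℝ) : MeasurableSet (translate Q x) :=
  (Q.isCompact.image (by fun_prop)).measurableSet

lemma controlFun_congr_ae {f g : ℝ → ℂ} (h : f =ᵐ[μ] g) :
    controlFun p θ μ Q f = controlFun p θ μ Q g := by
  ext x
  refine grandNorm_congr_ae ?_
  filter_upwards [h] with t ht
  simp [indicator, ht]

lemma measurable_controlFun [SFinite μ] {f : ℝ → ℂ} (hf : AEStronglyMeasurable f μ) :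
    Measurable (controlFun p θ μ Q f) := by
  rw [controlFun_congr_ae hf.ae_eq_mk]
  set g := hf.mk f
  have hg : Measurable g := hf.stronglyMeasurable_mk.measurable
  obtain ⟨D, hDc, hD⟩ := exists_countable_grandNorm_eq p θ
  have h : controlFun p θ μ Q g = fun x => ⨆ ε ∈ D, ENNReal.ofReal (ε ^ (θ / (p - ε))) *
      eLpNorm ((translate Q x).indicator g) (ENNReal.ofReal (p - ε)) μ := by
    ext x
    exact hD μ _ (hg.indicator (measurableSet_translate x))
  rw [h]
  refine Measurable.biSup D hDc fun ε _ => Measurable.const_mul ?_ _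
  have hjoint : Measurable fun z : ℝ × ℝ => (translate Q z.1).indicator g z.2 := by
    have : (fun z : ℝ × ℝ => (translate Q z.1).indicator g z.2)
        = {z : ℝ × ℝ | z.2 - z.1 ∈ Q}.indicator fun z => g z.2 := by
      ext z
      by_cases hz : z.2 - z.1 ∈ Q
      · rw [indicator_of_mem (mem_translate.2 hz),
          indicator_of_mem (s := {z : ℝ × ℝ | z.2 - z.1 ∈ Q}) hz]
      · rw [indicator_of_notMem fun h => hz (mem_translate.1 h),
          indicator_of_notMem (s := {z : ℝ × ℝ | z.2 - z.1 ∈ Q}) hz]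
    rw [this]
    refine (hg.comp measurable_snd).indicator ?_
    exact (measurable_snd.sub measurable_fst) Q.isCompact.measurableSet
  rcases le_or_gt (p - ε) 0 with h0 | h0
  · simp [ENNReal.ofReal_of_nonpos h0]
  simp_rw [eLpNorm_eq_lintegral_rpow_enorm_toReal (p := ENNReal.ofReal (p - ε)) (by simpa using h0)
    ENNReal.ofReal_ne_top]
  refine Measurable.pow_const ?_ _
  exact Measurable.lintegral_prod_right' (f := fun z : ℝ × ℝ =>
    ‖(translate Q z.1).indicator g z.2‖ₑ ^ (ENNReal.ofReal (p - ε)).toReal) (by fun_prop)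

lemma amalgamNorm_congr_ae {f g : ℝ → ℂ} (h : f =ᵐ[μ] g) :
    amalgamNorm p θ₁ q θ₂ μ Q f = amalgamNorm p θ₁ q θ₂ μ Q g := by
  simp only [amalgamNorm, controlFun_congr_ae h]

lemma amalgamNorm_add_le [SFinite μ] {f g : ℝ → ℂ} (hf : AEStronglyMeasurable f μ)
    (hg : AEStronglyMeasurable g μ) :
    amalgamNorm p θ₁ q θ₂ μ Q (f + g)
      ≤ amalgamNorm p θ₁ q θ₂ μ Q f + amalgamNorm p θ₁ q θ₂ μ Q g := by
  refine le_trans (grandNorm_mono (g := controlFun p θ₁ μ Q f + controlFun p θ₁ μ Q g)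
    fun x => ?_) (grandNorm_add_le (measurable_controlFun hf).aestronglyMeasurable
      (measurable_controlFun hg).aestronglyMeasurable)
  simp only [enorm_eq_self, controlFun, Pi.add_apply, indicator_add']
  exact grandNorm_add_le (hf.indicator (measurableSet_translate x))
    (hg.indicator (measurableSet_translate x))

lemma amalgamNorm_smul (a : ℂ) (f : ℝ → ℂ) :
    amalgamNorm p θ₁ q θ₂ μ Q (a • f) = ‖a‖ₑ * amalgamNorm p θ₁ q θ₂ μ Q f := by
  have : controlFun p θ₁ μ Q (a • f) = fun x => ‖a‖ₑ * controlFun p θ₁ μ Q f x := by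
    ext x
    have h : (translate Q x).indicator (a • f) = a • (translate Q x).indicator f := by
      ext t
      by_cases ht : t ∈ translate Q x <;> simp [ht]
    rw [controlFun, h, grandNorm_smul, controlFun]
  rw [amalgamNorm, this, grandNorm_enorm_mul, amalgamNorm]

end control

/-! ### The space -/

/-- The grand Wiener amalgam space `W(L^{p),θ₁}, L^{q),θ₂})(c, d)` with window `Q`, as a vector
space: all (classes of) measurable `f : (c, d) → ℂ` in `(L^{p),θ₁})_loc` whose control function
lies in `L^{q),θ₂}`. -/
def amalgamSubmodule (p θ₁ q θ₂ c d : ℝ) (Q : TopologicalSpace.Compacts ℝ) :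
    Submodule ℂ (ℝ →ₘ[intervalMeasure c d] ℂ) where
  carrier := {f | LocGrand p θ₁ c d f ∧ amalgamNorm p θ₁ q θ₂ (intervalMeasure c d) Q f < ∞}
  zero_mem' := by
    have h0 : ((0 : ℝ →ₘ[intervalMeasure c d] ℂ) : ℝ → ℂ) =ᵐ[intervalMeasure c d]
        (0 : ℂ) • (0 : ℝ → ℂ) := by
      filter_upwards [AEEqFun.coeFn_zero (α := ℝ) (β := ℂ) (μ := intervalMeasure c d)] with t ht
      simp [ht]
    refine ⟨fun K _ _ => ?_, ?_⟩
    · have : K.indicator ((0 : ℝ →ₘ[intervalMeasure c d] ℂ) : ℝ → ℂ) =ᵐ[intervalMeasure c d]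
          (0 : ℂ) • (0 : ℝ → ℂ) := by
        filter_upwards [h0] with t ht
        simp only [indicator, ht]
        simp
      rw [grandNorm_congr_ae this, grandNorm_smul]
      simp
    · rw [amalgamNorm_congr_ae h0, amalgamNorm_smul]
      simp
  add_mem' := by
    rintro f g ⟨hf, hf'⟩ ⟨hg, hg'⟩
    have h := AEEqFun.coeFn_add f g
    refine ⟨fun K hK hKs => ?_, ?_⟩
    · have : K.indicator ((f + g : ℝ →ₘ[intervalMeasure c d] ℂ) : ℝ → ℂ)
          =ᵐ[intervalMeasure c d] K.indicator f + K.indicator g := by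
        filter_upwards [h] with t ht
        simp only [indicator, ht, Pi.add_apply]
        split_ifs <;> simp
      rw [grandNorm_congr_ae this]
      exact (grandNorm_add_le (f.aestronglyMeasurable.indicator hK.measurableSet)
        (g.aestronglyMeasurable.indicator hK.measurableSet)).trans_lt
          (ENNReal.add_lt_top.2 ⟨hf K hK hKs, hg K hK hKs⟩)
    · rw [amalgamNorm_congr_ae h]
      exact (amalgamNorm_add_le f.aestronglyMeasurable g.aestronglyMeasurable).trans_lt
        (ENNReal.add_lt_top.2 ⟨hf', hg'⟩)
  smul_mem' := by
    rintro a f ⟨hf, hf'⟩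
    have h := AEEqFun.coeFn_smul a f
    refine ⟨fun K hK hKs => ?_, ?_⟩
    · have : K.indicator ((a • f : ℝ →ₘ[intervalMeasure c d] ℂ) : ℝ → ℂ)
          =ᵐ[intervalMeasure c d] a • K.indicator f := by
        filter_upwards [h] with t ht
        simp only [indicator, ht, Pi.smul_apply]
        split_ifs <;> simp
      rw [grandNorm_congr_ae this, grandNorm_smul]
      exact ENNReal.mul_lt_top enorm_lt_top (hf K hK hKs)
    · rw [amalgamNorm_congr_ae h, amalgamNorm_smul]
      exact ENNReal.mul_lt_top enorm_lt_top hf'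

/-- The grand Wiener amalgam space `W(L^{p),θ₁}, L^{q),θ₂})(c, d)` with window `Q`. -/
def GrandAmalgam (p θ₁ q θ₂ c d : ℝ) (Q : TopologicalSpace.Compacts ℝ) : Type :=
  amalgamSubmodule p θ₁ q θ₂ c d Q

section instances

variable (p θ₁ q θ₂ c d : ℝ) (Q : TopologicalSpace.Compacts ℝ)

instance : AddCommGroup (GrandAmalgam p θ₁ q θ₂ c d Q) :=
  inferInstanceAs (AddCommGroup (amalgamSubmodule p θ₁ q θ₂ c d Q))

instance : Module ℂ (GrandAmalgam p θ₁ q θ₂ c d Q) :=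
  inferInstanceAs (Module ℂ (amalgamSubmodule p θ₁ q θ₂ c d Q))

/-- `‖f‖ = ‖ ‖f χ_{Q + x}‖_{p),θ₁} ‖_{q),θ₂}`. -/
instance : Norm (GrandAmalgam p θ₁ q θ₂ c d Q) where
  norm f := (amalgamNorm p θ₁ q θ₂ (intervalMeasure c d) Q (f.1 : ℝ → ℂ)).toReal

lemma seminormedCore : SeminormedSpace.Core ℂ (GrandAmalgam p θ₁ q θ₂ c d Q) where
  norm_nonneg _ := ENNReal.toReal_nonneg
  norm_smul a f := by
    change (amalgamNorm p θ₁ q θ₂ (intervalMeasure c d) Q ((a • f.1 : _ →ₘ[_] ℂ) : ℝ → ℂ)).toReal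
      = ‖a‖ * (amalgamNorm p θ₁ q θ₂ (intervalMeasure c d) Q (f.1 : ℝ → ℂ)).toReal
    rw [amalgamNorm_congr_ae (AEEqFun.coeFn_smul a f.1), amalgamNorm_smul]
    simp
  norm_triangle f g := by
    change (amalgamNorm p θ₁ q θ₂ (intervalMeasure c d) Q ((f.1 + g.1 : _ →ₘ[_] ℂ) : ℝ → ℂ)).toReal
      ≤ (amalgamNorm p θ₁ q θ₂ (intervalMeasure c d) Q (f.1 : ℝ → ℂ)).toReal
        + (amalgamNorm p θ₁ q θ₂ (intervalMeasure c d) Q (g.1 : ℝ → ℂ)).toReal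
    rw [amalgamNorm_congr_ae (AEEqFun.coeFn_add f.1 g.1), ← ENNReal.toReal_add f.2.2.ne g.2.2.ne]
    exact ENNReal.toReal_mono (ENNReal.add_ne_top.2 ⟨f.2.2.ne, g.2.2.ne⟩)
      (amalgamNorm_add_le f.1.aestronglyMeasurable g.1.aestronglyMeasurable)

instance : SeminormedAddCommGroup (GrandAmalgam p θ₁ q θ₂ c d Q) :=
  SeminormedAddCommGroup.ofCore (seminormedCore p θ₁ q θ₂ c d Q)

instance : NormedSpace ℂ (GrandAmalgam p θ₁ q θ₂ c d Q) where
  norm_smul_le a f := ((seminormedCore p θ₁ q θ₂ c d Q).norm_smul a f).le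

end instances

/-- A (semi)normed space is reflexive if the canonical map into its bidual is onto. For a seminorm
this is the same as reflexivity of the quotient by the vectors of zero seminorm. -/
def IsReflexive (E : Type*) [SeminormedAddCommGroup E] [NormedSpace ℂ E] : Prop :=
  Function.Surjective (NormedSpace.inclusionInDoubleDual ℂ E)

end GrandWiener

end

/-! The space contains a sequence equivalent to the unit vector basis of `c₀`, spanned by disjoint
steps. Put `x_n = κ 2^n` and take blocks of measure about `e^(-x_n)` carrying the height `x_n^(θ/p)
e^(x_n/p)`. At exponent `p - ε` the weighted integral of block `n` is, up to constants, at most `v(ε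
x_n)` with `v r = r^θ e^(-r/p)`. Since `v` decays at `0` and at `∞` and the `x_n` are geometric,
these bounds sum to a constant independent of `ε` (`grandNorm_stepFun_unitSum_le`). At `ε = 1/x_n`
block `n` alone is already bounded below (`le_grandNorm_stepFun_single`). All blocks lie in a ball
contained in `Q + x` for every `x` near some `x₀`, so on such steps the amalgam norm is comparable
to the grand norm (`amalgamNorm_le`, `le_amalgamNorm`). Reflexivity would give a point in the closed
convex hull of every tail of the bounded partial sums, which the lower bound on coordinates forbids
(`not_isReflexive_of_finsupp`). -/

namespace GrandWiener

/-! ### Weak compactness and copies of `c₀`. -/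

section reflexivity

variable {E : Type*} [SeminormedAddCommGroup E] [NormedSpace ℂ E]

/-- In a reflexive space a bounded sequence has a point lying in the closed convex hulls of all its
tails. -/
lemma IsReflexive.exists_mem_closure_convexHull (hE : IsReflexive E) {g : ℕ → E} {C : ℝ}
    (hg : ∀ n, ‖g n‖ ≤ C) :
    ∃ x, ∀ n, x ∈ closure (convexHull ℝ (g '' Ici n)) := by
  let J : ℕ → WeakDual ℂ (StrongDual ℂ E) := fun n =>
    StrongDual.toWeakDual (NormedSpace.inclusionInDoubleDual ℂ E (g n))
  have hJ : ∀ n, J n ∈ WeakDual.toStrongDual ⁻¹' Metric.closedBall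
      (0 : StrongDual ℂ (StrongDual ℂ E)) C := fun n => by
    have : ‖NormedSpace.inclusionInDoubleDual ℂ E (g n)‖ ≤ C := by
      refine ContinuousLinearMap.opNorm_le_bound _ ((norm_nonneg _).trans (hg n)) fun f => ?_
      rw [NormedSpace.dual_def, mul_comm]
      exact (f.le_opNorm _).trans (by gcongr; exact hg n)
    rw [mem_preimage, Metric.mem_closedBall]
    refine (le_of_eq ?_).trans this
    exact dist_zero_right (NormedSpace.inclusionInDoubleDual ℂ E (g n))
  -- Banach–Alaoglu in the bidual gives a weak-* cluster point; reflexivity makes it evaluation at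
  -- some `x`.
  obtain ⟨Φ, -, hΦ⟩ := (WeakDual.isCompact_closedBall (𝕜 := ℂ)
    (0 : StrongDual ℂ (StrongDual ℂ E)) C).exists_mapClusterPt (f := (atTop : Filter ℕ)) (u := J)
      (tendsto_principal.2 (Eventually.of_forall hJ))
  obtain ⟨x, hx⟩ := hE (WeakDual.toStrongDual Φ)
  refine ⟨x, fun n => ?_⟩
  -- A functional separating `x` from a tail would keep that tail out of a weak-* neighbourhood of
  -- `Φ`.
  by_contra hxn
  obtain ⟨f, u, hfu, hu⟩ := RCLike.geometric_hahn_banach_point_closed (𝕜 := ℂ)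
    (convex_convexHull ℝ (g '' Ici n)).closure isClosed_closure hxn
  have hΦf : Φ f = f x := by
    have := congrArg (fun Ψ => Ψ f) hx
    simpa using this.symm
  have hopen : {Ψ : WeakDual ℂ (StrongDual ℂ E) | (Ψ f).re < u} ∈ 𝓝 Φ := by
    refine (isOpen_Iio.preimage
      (Complex.continuous_re.comp (WeakDual.eval_continuous f))).mem_nhds ?_
    simpa [hΦf] using hfu
  obtain ⟨m, hm, hmn⟩ := ((hΦ.frequently hopen).and_eventually (eventually_ge_atTop n)).exists
  have h2 := hu (g m) (subset_closure (subset_convexHull ℝ _ ⟨m, hmn, rfl⟩))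
  have h3 : (f (g m)).re < u := hm
  exact lt_asymm h2 h3

/-- A space containing a sequence equivalent to the unit vector basis of `c₀` is not reflexive. -/
lemma not_isReflexive_of_finsupp (T : (ℕ →₀ ℂ) →ₗ[ℂ] E) {a C : ℝ} (ha : 0 < a)
    (hlow : ∀ b n, a * ‖b n‖ ≤ ‖T b‖)
    (hup : ∀ N, ‖T (∑ m ∈ Finset.range N, Finsupp.single m 1)‖ ≤ C) : ¬ IsReflexive E := by
  intro hE
  set s : ℕ → ℕ →₀ ℂ := fun N => ∑ m ∈ Finset.range N, Finsupp.single m 1 with hs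
  obtain ⟨x, hx⟩ := hE.exists_mem_closure_convexHull hup
  have himage : ∀ n, convexHull ℝ ((fun N => T (s N)) '' Ici n)
      = T '' convexHull ℝ (s '' Ici n) := fun n => by
    have := (T.restrictScalars ℝ).image_convexHull (s '' Ici n)
    simp only [LinearMap.coe_restrictScalars] at this
    rw [this, image_image]
  have happrox : ∀ n, ∃ b ∈ convexHull ℝ (s '' Ici n), dist x (T b) < a / 2 := fun n => by
    obtain ⟨y, hy, hxy⟩ := Metric.mem_closure_iff.1 (hx n) (a / 2) (half_pos ha)
    rw [himage] at hy
    obtain ⟨b, hb, rfl⟩ := hy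
    exact ⟨b, hb, hxy⟩
  obtain ⟨b, -, hb⟩ := happrox 0
  -- Coordinate `n` is `0` for `b`, but `1` on the hull of the tail from `n + 1`: this affine
  -- condition holds for `s N` whenever `N > n`. So `T b` and `T b'` are at least `a` apart, yet
  -- both lie within `a / 2` of `x`.
  obtain ⟨n, hn⟩ := Infinite.exists_notMem_finset b.support
  obtain ⟨b', hb', hxb'⟩ := happrox (n + 1)
  have hcoord : b' n = 1 := by
    refine convexHull_min (t := {b : ℕ →₀ ℂ | b n = 1}) ?_ ?_ hb'
    · rintro _ ⟨N, hN, rfl⟩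
      have : n < N := hN
      simp [hs, Finsupp.finsetSum_apply, Finsupp.single_apply, this]
    · intro y hy z hz α β _ _ hαβ
      have hy' : y n = 1 := hy
      have hz' : z n = 1 := hz
      have : (α : ℂ) + β = 1 := by exact_mod_cast hαβ
      simp [hy', hz', this]
  have h := hlow (b' - b) n
  have hbn : b n = 0 := by simpa using hn
  rw [Finsupp.sub_apply, hcoord, hbn, map_sub, sub_zero, norm_one, mul_one, ← dist_eq_norm] at h
  have := dist_triangle_left (T b') (T b) x
  linarith

end reflexivity

/-! ### Scalar estimates for one block. -/

section estimates

/-- A polynomial times a decaying exponential is bounded on `[0, ∞)`. -/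
lemma exists_exp_mul_le {θ b : ℝ} (hθ : 0 < θ) (hb : 0 < b) :
    ∃ K, 0 < K ∧ ∀ r, 0 ≤ r →
      Real.exp (-(b * r)) * ((1 + r ^ θ) * (1 + 2 ^ θ * r ^ θ)) ≤ K := by
  obtain ⟨m, hm⟩ := exists_nat_ge θ
  refine ⟨8 * (2 ^ θ + 1) * (1 + (2 * m).factorial / b ^ (2 * m)), by positivity, fun r hr => ?_⟩
  have h2 : (0 : ℝ) < 2 ^ θ := by positivity
  have hrm : r ^ θ ≤ 1 + r ^ m := by
    rcases le_total r 1 with h | h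
    · exact (Real.rpow_le_one hr h hθ.le).trans (by linarith [pow_nonneg hr m])
    · refine (Real.rpow_le_rpow_of_exponent_le h hm).trans ?_
      rw [Real.rpow_natCast]; linarith
  have hr0 : 0 ≤ r ^ θ := by positivity
  have hpoly : (1 + r ^ θ) * (1 + 2 ^ θ * r ^ θ) ≤ (2 ^ θ + 1) * (8 + 2 * r ^ (2 * m)) := by
    have h1 : 1 + 2 ^ θ * r ^ θ ≤ (2 ^ θ + 1) * (1 + r ^ θ) := by nlinarith
    have h3 : (1 + r ^ θ) ^ 2 ≤ (2 + r ^ m) ^ 2 := pow_le_pow_left₀ (by positivity) (by linarith) 2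
    have h4 : (2 + r ^ m) ^ 2 ≤ 8 + 2 * r ^ (2 * m) := by
      rw [pow_mul' r 2 m]; nlinarith [sq_nonneg (2 - r ^ m)]
    calc (1 + r ^ θ) * (1 + 2 ^ θ * r ^ θ)
        ≤ (1 + r ^ θ) * ((2 ^ θ + 1) * (1 + r ^ θ)) := by gcongr
      _ = (2 ^ θ + 1) * (1 + r ^ θ) ^ 2 := by ring
      _ ≤ _ := by gcongr; linarith
  have hexp : Real.exp (-(b * r)) * r ^ (2 * m) ≤ (2 * m).factorial / b ^ (2 * m) := by
    have := Real.pow_div_factorial_le_exp (b * r) (by positivity) (2 * m)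
    rw [div_le_iff₀ (by positivity), mul_pow] at this
    rw [Real.exp_neg, le_div_iff₀ (by positivity), inv_mul_eq_div, div_mul_eq_mul_div,
      div_le_iff₀ (Real.exp_pos _)]
    linarith
  have he1 : Real.exp (-(b * r)) ≤ 1 := by
    rw [Real.exp_le_one_iff]; nlinarith
  calc Real.exp (-(b * r)) * ((1 + r ^ θ) * (1 + 2 ^ θ * r ^ θ))
      ≤ Real.exp (-(b * r)) * ((2 ^ θ + 1) * (8 + 2 * r ^ (2 * m))) := by gcongr
    _ = (2 ^ θ + 1) * (8 * Real.exp (-(b * r)) + 2 * (Real.exp (-(b * r)) * r ^ (2 * m))) := by ring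
    _ ≤ (2 ^ θ + 1) * (8 * 1 + 2 * ((2 * m).factorial / b ^ (2 * m))) := by gcongr
    _ ≤ (2 ^ θ + 1) * (8 * 1 + 8 * ((2 * m).factorial / b ^ (2 * m))) := by gcongr; norm_num
    _ = _ := by ring

/-- The sums `∑ v (2 ^ n s)`, with `v r = r ^ θ e ^ (-b r)`, are bounded uniformly in `s`. -/
lemma exists_sum_rpow_mul_exp_le {θ b : ℝ} (hθ : 0 < θ) (hb : 0 < b) :
    ∃ K, 0 < K ∧ ∀ s, 0 ≤ s → ∀ N : ℕ,
      ∑ n ∈ Finset.range N, (s * 2 ^ n) ^ θ * Real.exp (-(b * (s * 2 ^ n))) ≤ K := by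
  obtain ⟨K, hK, h⟩ := exists_exp_mul_le hθ hb
  have h2 : (1 : ℝ) < 2 ^ θ := Real.one_lt_rpow (by norm_num) hθ
  refine ⟨K / (2 ^ θ - 1), div_pos hK (by linarith), fun s hs N => ?_⟩
  -- Telescoping majorant: `H` takes values in `[0, 1]`, and its increment has denominator `(1 +
  -- r^θ)(1 + 2^θ r^θ)`, exactly the factor that the exponential absorbs in `exists_exp_mul_le`.
  set H : ℕ → ℝ := fun n => (s * 2 ^ n) ^ θ / (1 + (s * 2 ^ n) ^ θ) with hH
  have hterm : ∀ n, (s * 2 ^ n) ^ θ * Real.exp (-(b * (s * 2 ^ n)))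
      ≤ K / (2 ^ θ - 1) * (H (n + 1) - H n) := fun n => by
    set r := s * 2 ^ n with hr
    have hr0 : 0 ≤ r := by positivity
    have hrs : (s * 2 ^ (n + 1)) ^ θ = 2 ^ θ * r ^ θ := by
      rw [← Real.mul_rpow (by norm_num) hr0, hr]; ring_nf
    have hd : H (n + 1) - H n
        = (2 ^ θ - 1) * (r ^ θ / ((1 + r ^ θ) * (1 + 2 ^ θ * r ^ θ))) := by
      simp only [hH, hrs, ← hr]
      have h0 : 0 ≤ r ^ θ := by positivity
      field_simp
      ring
    have h0 : 0 ≤ r ^ θ := by positivity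
    have h3 : (2 : ℝ) ^ θ - 1 ≠ 0 := by linarith
    rw [hd, ← mul_assoc (K / _), div_mul_cancel₀ _ h3, ← mul_div_assoc, le_div_iff₀ (by positivity)]
    calc _ = Real.exp (-(b * r)) * ((1 + r ^ θ) * (1 + 2 ^ θ * r ^ θ)) * r ^ θ := by ring
      _ ≤ _ := by gcongr; exact h r hr0
  refine (Finset.sum_le_sum fun n _ => hterm n).trans ?_
  rw [← Finset.mul_sum, Finset.sum_range_sub]
  have hN : H N - H 0 ≤ 1 := by
    have h1 : H N ≤ 1 := by
      have : 0 ≤ (s * 2 ^ N) ^ θ := by positivity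
      simp only [hH]
      rw [div_le_one (by positivity)]; linarith
    have h0 : 0 ≤ H 0 := by simp only [hH]; positivity
    linarith
  exact mul_le_of_le_one_right (div_pos hK (by linarith)).le hN

/-- The height of the block of measure comparable to `e ^ (-x)`. -/
noncomputable def height (p θ x : ℝ) : ℝ := x ^ (θ / p) * Real.exp (x / p)

lemma height_pos {p θ x : ℝ} (hx : 0 < x) : 0 < height p θ x := by
  unfold height; positivity

lemma height_rpow_mul_exp {p θ x ε : ℝ} (hp : 0 < p) (hx : 0 < x) :
    height p θ x ^ (p - ε) * Real.exp (-x)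
      = x ^ θ * x ^ (-(θ * ε / p)) * Real.exp (-(p⁻¹ * (ε * x))) := by
  rw [height, Real.mul_rpow (by positivity) (by positivity), ← Real.rpow_mul hx.le,
    ← Real.exp_mul, mul_assoc, ← Real.exp_add, ← Real.rpow_add hx]
  congr 2
  · field_simp; ring
  · field_simp; ring

/-- Apart from the factor `x^(-θε/p)`, at most `1` because `x ≥ 1`, the left side depends only on `ε
x`. -/
lemma rpow_mul_height_rpow_le {p θ x ε : ℝ} (hp : 0 < p) (hθ : 0 < θ) (hx : 1 ≤ x) (hε : 0 < ε) :
    ε ^ θ * (height p θ x ^ (p - ε) * Real.exp (-x))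
      ≤ (ε * x) ^ θ * Real.exp (-(p⁻¹ * (ε * x))) := by
  have hx0 : 0 < x := by linarith
  rw [height_rpow_mul_exp hp hx0, Real.mul_rpow hε.le hx0.le]
  have h1 : x ^ (-(θ * ε / p)) ≤ 1 :=
    Real.rpow_le_one_of_one_le_of_nonpos hx (by simp; positivity)
  calc _ = ε ^ θ * x ^ θ * Real.exp (-(p⁻¹ * (ε * x))) * x ^ (-(θ * ε / p)) := by ring
    _ ≤ _ := mul_le_of_le_one_right (by positivity) h1

/-- This is the case `ε = 1/x`: the exponential contributes `e^(-1/p)`, and `log x ≤ x` bounds the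
leftover power of `x` below by `e^(-θ/p)`. -/
lemma le_rpow_mul_height_rpow {p θ x : ℝ} (hp : 0 < p) (hθ : 0 < θ) (hx : 0 < x) :
    Real.exp (-((θ + 1) / p))
      ≤ x⁻¹ ^ θ * (height p θ x ^ (p - x⁻¹) * Real.exp (-x)) := by
  have hlog : Real.log x ≤ x := (Real.log_le_sub_one_of_pos hx).trans (by linarith)
  rw [height_rpow_mul_exp hp hx, ← mul_assoc, ← mul_assoc, ← Real.mul_rpow (by positivity) hx.le,
    inv_mul_cancel₀ hx.ne', Real.one_rpow, one_mul, mul_one, Real.rpow_def_of_pos hx,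
    ← Real.exp_add, Real.exp_le_exp]
  have : Real.log x * (θ * x⁻¹ / p) ≤ θ / p := by
    calc Real.log x * (θ * x⁻¹ / p) ≤ x * (θ * x⁻¹ / p) := by gcongr
      _ = θ / p := by field_simp
  have h1 : Real.log x * -(θ * x⁻¹ / p) = -(Real.log x * (θ * x⁻¹ / p)) := by ring
  rw [add_div, h1, one_div]
  linarith

end estimates

/-! ### Comparing the amalgam norm with the grand norm. -/

section norms

variable {α F : Type*} [MeasurableSpace α] {μ : Measure α}

lemma le_grandNorm [ENorm F] {p θ ε : ℝ} (hε : ε ∈ Ioc (0 : ℝ) (p - 1)) (f : α → F) :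
    ENNReal.ofReal (ε ^ (θ / (p - ε))) * eLpNorm f (ENNReal.ofReal (p - ε)) μ
      ≤ grandNorm p θ μ f :=
  le_iSup₂ (f := fun ε _ => ENNReal.ofReal (ε ^ (θ / (p - ε))) *
    eLpNorm f (ENNReal.ofReal (p - ε)) μ) ε hε

/-- With the weight inside the root, it suffices to bound `ε^θ ∫ |f|^r`. -/
lemma ofReal_rpow_mul_eLpNorm [ENorm F] {θ ε r : ℝ} (hε : 0 < ε) (hr : 0 < r) (f : α → F) :
    ENNReal.ofReal (ε ^ (θ / r)) * eLpNorm f (ENNReal.ofReal r) μ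
      = (ENNReal.ofReal (ε ^ θ) * ∫⁻ t, ‖f t‖ₑ ^ r ∂μ) ^ r⁻¹ := by
  rw [eLpNorm_eq_lintegral_rpow_enorm_toReal (by simpa using hr) ENNReal.ofReal_ne_top,
    ENNReal.toReal_ofReal hr.le, ENNReal.mul_rpow_of_nonneg _ _ (by positivity), one_div,
    ENNReal.ofReal_rpow_of_nonneg (by positivity) (by positivity), ← Real.rpow_mul hε.le,
    div_eq_mul_inv]

lemma grandNorm_one_lt_top [IsFiniteMeasure μ] {q θ : ℝ} (hθ : 0 < θ) :
    grandNorm q θ μ (fun _ : α => (1 : ℝ≥0∞)) < ∞ := by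
  -- The `1` in the maximum lets roots of order `q - ε ≥ 1` be dropped: `B^(1/r) ≤ B`.
  set B : ℝ≥0∞ := max 1 (ENNReal.ofReal (q ^ θ) * μ univ) with hB
  have hBtop : B < ∞ := max_lt ENNReal.one_lt_top
    (ENNReal.mul_lt_top ENNReal.ofReal_lt_top (measure_lt_top μ _))
  refine lt_of_le_of_lt (iSup₂_le fun ε hε => ?_) hBtop
  have hr : 1 ≤ q - ε := by linarith [hε.2]
  rw [ofReal_rpow_mul_eLpNorm hε.1 (by linarith)]
  simp only [enorm_eq_self, ENNReal.one_rpow, lintegral_const, one_mul]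
  calc (ENNReal.ofReal (ε ^ θ) * μ univ) ^ (q - ε)⁻¹ ≤ B ^ (q - ε)⁻¹ := by
        gcongr
        refine le_trans ?_ (le_max_right _ _)
        have : ε ^ θ ≤ q ^ θ := Real.rpow_le_rpow hε.1.le (by linarith) hθ.le
        gcongr
    _ ≤ B ^ (1 : ℝ) :=
        ENNReal.rpow_le_rpow_of_exponent_le (le_max_left _ _) (inv_le_one_of_one_le₀ hr)
    _ = B := ENNReal.rpow_one _

lemma controlFun_le {p θ : ℝ} {μ : Measure ℝ} {Q : TopologicalSpace.Compacts ℝ} (f : ℝ → ℂ)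
    (x : ℝ) : controlFun p θ μ Q f x ≤ grandNorm p θ μ f :=
  grandNorm_mono fun t => by
    by_cases ht : t ∈ translate Q x <;> simp [ht]

lemma amalgamNorm_le {p θ₁ q θ₂ : ℝ} {μ : Measure ℝ} {Q : TopologicalSpace.Compacts ℝ} {f : ℝ → ℂ}
    (hf : grandNorm p θ₁ μ f ≠ ∞) :
    amalgamNorm p θ₁ q θ₂ μ Q f
      ≤ grandNorm p θ₁ μ f * grandNorm q θ₂ μ (fun _ : ℝ => (1 : ℝ≥0∞)) := by
  -- The finite constant is written as the norm of a scalar so that homogeneity applies.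
  have h : ‖((grandNorm p θ₁ μ f).toReal : ℂ)‖ₑ = grandNorm p θ₁ μ f := by
    rw [← ofReal_norm, Complex.norm_real, Real.norm_of_nonneg ENNReal.toReal_nonneg,
      ENNReal.ofReal_toReal hf]
  rw [← h, ← grandNorm_enorm_mul, h]
  refine grandNorm_mono fun x => ?_
  simpa using controlFun_le f x

/-- For `x ∈ B` the window sees the whole support of `f`, so the control function is constant on
`B`. The choice `ε = q - 1` turns the outer norm into a weighted integral. -/
lemma le_amalgamNorm {p θ₁ q θ₂ : ℝ} {μ : Measure ℝ} {Q : TopologicalSpace.Compacts ℝ} {f : ℝ → ℂ}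
    {B : Set ℝ} (hq : 1 < q) (hB : MeasurableSet B)
    (hf : ∀ x ∈ B, ∀ t ∉ translate Q x, f t = 0) :
    ENNReal.ofReal ((q - 1) ^ θ₂) * μ B * grandNorm p θ₁ μ f ≤ amalgamNorm p θ₁ q θ₂ μ Q f := by
  have hc : ∀ x ∈ B, controlFun p θ₁ μ Q f x = grandNorm p θ₁ μ f := fun x hx => by
    rw [controlFun, indicator_eq_self.2 fun t ht => by_contra fun h => ht (hf x hx t h)]
  refine le_trans ?_ (le_grandNorm (ε := q - 1) ⟨by linarith, le_rfl⟩ _)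
  rw [ofReal_rpow_mul_eLpNorm (by linarith) (by linarith)]
  simp only [sub_sub_cancel, inv_one, ENNReal.rpow_one, enorm_eq_self]
  rw [mul_assoc]
  gcongr
  calc μ B * grandNorm p θ₁ μ f = ∫⁻ x in B, controlFun p θ₁ μ Q f x ∂μ := by
        rw [setLIntegral_congr_fun hB hc, setLIntegral_const, mul_comm]
    _ ≤ _ := setLIntegral_le_lintegral _ _

end norms

/-! ### Step functions on disjoint sets. -/

section steps

variable (A : ℕ → Set ℝ) (l : ℕ → ℝ)

/-- The step function with value `b n * l n` on `A n`. -/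
noncomputable def stepFun (b : ℕ →₀ ℂ) (t : ℝ) : ℂ :=
  b.sum fun n z => (A n).indicator (fun _ => z * l n) t

variable {A l}

lemma stepFun_add (b b' : ℕ →₀ ℂ) : stepFun A l (b + b') = stepFun A l b + stepFun A l b' := by
  ext t
  refine Finsupp.sum_add_index' (fun n => ?_) fun n y z => ?_
  · simp
  · by_cases h : t ∈ A n <;> simp [h, add_mul]

lemma stepFun_single (n : ℕ) (z : ℂ) :
    stepFun A l (Finsupp.single n z) = z • (A n).indicator fun _ => (l n : ℂ) := by
  ext t
  rw [stepFun, Finsupp.sum_single_index (by simp)]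
  by_cases h : t ∈ A n <;> simp [h]

lemma stepFun_of_mem (hA : Pairwise (Function.onFun Disjoint A)) {n : ℕ} {t : ℝ} (ht : t ∈ A n)
    (b : ℕ →₀ ℂ) : stepFun A l b t = b n * l n := by
  rw [stepFun, Finsupp.sum, Finset.sum_eq_single n]
  · simp [ht]
  · intro m _ hm
    exact indicator_of_notMem (fun h => (hA hm).le_bot ⟨h, ht⟩) _
  · intro h
    simp [Finsupp.notMem_support_iff.1 h]

lemma stepFun_of_notMem {t : ℝ} (ht : ∀ n, t ∉ A n) (b : ℕ →₀ ℂ) : stepFun A l b t = 0 :=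
  Finset.sum_eq_zero fun n _ => indicator_of_notMem (ht n) _

/-- Source of the lower `c₀` estimate: a step function dominates each of its pieces. -/
lemma enorm_stepFun_single_le (hA : Pairwise (Function.onFun Disjoint A)) (b : ℕ →₀ ℂ) (n : ℕ)
    (t : ℝ) : ‖stepFun A l (Finsupp.single n (b n)) t‖ₑ ≤ ‖stepFun A l b t‖ₑ := by
  by_cases ht : t ∈ A n
  · simp [stepFun_of_mem hA ht]
  · simp [stepFun_single, ht]

/-- The sum of the first `N` unit vectors. -/
noncomputable def unitSum (N : ℕ) : ℕ →₀ ℂ := ∑ m ∈ Finset.range N, Finsupp.single m 1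

lemma unitSum_apply (N n : ℕ) : unitSum N n = if n < N then 1 else 0 := by
  simp [unitSum, Finsupp.finsetSum_apply, Finsupp.single_apply]

lemma enorm_stepFun_unitSum_rpow (hA : Pairwise (Function.onFun Disjoint A)) (hl : ∀ n, 0 < l n)
    {r : ℝ} (hr : 0 < r) (N : ℕ) (t : ℝ) :
    ‖stepFun A l (unitSum N) t‖ₑ ^ r
      = ∑ n ∈ Finset.range N, (A n).indicator (fun _ => ENNReal.ofReal (l n ^ r)) t := by
  by_cases h : ∃ n, t ∈ A n
  · obtain ⟨n, ht⟩ := h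
    have h0 : ∀ m ∈ Finset.range N, m ≠ n →
        (A m).indicator (fun _ => ENNReal.ofReal (l m ^ r)) t = 0 := fun m _ hm =>
      indicator_of_notMem (fun h => (hA hm).le_bot ⟨h, ht⟩) _
    rw [stepFun_of_mem hA ht, unitSum_apply]
    split_ifs with hn
    · rw [Finset.sum_eq_single n h0 fun h => (h (Finset.mem_range.2 hn)).elim, one_mul,
        indicator_of_mem ht, ← ofReal_norm, Complex.norm_real, Real.norm_of_nonneg (hl n).le,
        ENNReal.ofReal_rpow_of_nonneg (hl n).le hr.le]
    · rw [Finset.sum_eq_zero fun m hm => h0 m hm fun h => hn (h ▸ Finset.mem_range.1 hm)]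
      simp [hr]
  · push Not at h
    rw [stepFun_of_notMem h, Finset.sum_eq_zero fun m _ => indicator_of_notMem (h m) _]
    simp [hr]

lemma lintegral_stepFun_unitSum (hA : Pairwise (Function.onFun Disjoint A))
    (hm : ∀ n, MeasurableSet (A n)) (hl : ∀ n, 0 < l n) (μ : Measure ℝ) {r : ℝ} (hr : 0 < r)
    (N : ℕ) :
    ∫⁻ t, ‖stepFun A l (unitSum N) t‖ₑ ^ r ∂μ
      = ∑ n ∈ Finset.range N, ENNReal.ofReal (l n ^ r) * μ (A n) := by
  simp_rw [enorm_stepFun_unitSum_rpow hA hl hr]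
  rw [lintegral_finsetSum _ fun n _ => measurable_const.indicator (hm n)]
  exact Finset.sum_congr rfl fun n _ => lintegral_indicator_const (hm n) _

variable {p θ κ : ℝ} {μ : Measure ℝ}

/-- Disjointness turns the integral into a sum, bounded through `exists_sum_rpow_mul_exp_le` at `s =
ε κ`. That bound is uniform in `s`, hence in `ε`; the `1` in the maximum absorbs the root. -/
lemma grandNorm_stepFun_unitSum_le (hp : 0 < p) (hθ : 0 < θ) (hκ : 1 ≤ κ) :
    ∃ K, 0 < K ∧ ∀ A : ℕ → Set ℝ, Pairwise (Function.onFun Disjoint A) →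
      (∀ n, MeasurableSet (A n)) → ∀ M, 0 < M →
      (∀ n, μ (A n) ≤ ENNReal.ofReal (M * Real.exp (-(κ * 2 ^ n)))) → ∀ N,
      grandNorm p θ μ (stepFun A (fun n => height p θ (κ * 2 ^ n)) (unitSum N))
        ≤ ENNReal.ofReal (max 1 (M * K)) := by
  obtain ⟨K, hK, hsum⟩ := exists_sum_rpow_mul_exp_le hθ (inv_pos.2 hp)
  refine ⟨K, hK, fun A hA hm M hM hμ N => iSup₂_le fun ε hε => ?_⟩
  have hr : 1 ≤ p - ε := by linarith [hε.2]
  have hx : ∀ n : ℕ, 1 ≤ κ * 2 ^ n := fun n =>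
    one_le_mul_of_one_le_of_one_le hκ (one_le_pow₀ (by norm_num))
  have hl : ∀ n : ℕ, 0 < height p θ (κ * 2 ^ n) := fun n => height_pos (by linarith [hx n])
  rw [ofReal_rpow_mul_eLpNorm hε.1 (by linarith),
    lintegral_stepFun_unitSum hA hm hl μ (by linarith), Finset.mul_sum]
  have hle : ∑ n ∈ Finset.range N, ENNReal.ofReal (ε ^ θ) *
      (ENNReal.ofReal (height p θ (κ * 2 ^ n) ^ (p - ε)) * μ (A n))
        ≤ ENNReal.ofReal (max 1 (M * K)) := by
    calc _ ≤ ∑ n ∈ Finset.range N, ENNReal.ofReal (M * ((ε * κ * 2 ^ n) ^ θ *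
          Real.exp (-(p⁻¹ * (ε * κ * 2 ^ n))))) := by
          refine Finset.sum_le_sum fun n _ => ?_
          have h := rpow_mul_height_rpow_le hp hθ (hx n) hε.1
          rw [← mul_assoc ε κ] at h
          refine (mul_le_mul_right (mul_le_mul_right (hμ n) _) _).trans ?_
          have h1 : 0 ≤ height p θ (κ * 2 ^ n) ^ (p - ε) := Real.rpow_nonneg (hl n).le _
          have h2 : 0 ≤ ε ^ θ := Real.rpow_nonneg hε.1.le _
          rw [← ENNReal.ofReal_mul h1, ← ENNReal.ofReal_mul h2]
          refine ENNReal.ofReal_le_ofReal ?_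
          calc _ = M * (ε ^ θ * (height p θ (κ * 2 ^ n) ^ (p - ε) *
                Real.exp (-(κ * 2 ^ n)))) := by ring
            _ ≤ _ := by gcongr
      _ = ENNReal.ofReal (M * ∑ n ∈ Finset.range N, (ε * κ * 2 ^ n) ^ θ *
          Real.exp (-(p⁻¹ * (ε * κ * 2 ^ n)))) := by
          rw [Finset.mul_sum, ENNReal.ofReal_sum_of_nonneg]
          intro n _
          have := hε.1
          positivity
      _ ≤ _ := by
          refine ENNReal.ofReal_le_ofReal (le_trans ?_ (le_max_right _ _))
          gcongr
          exact hsum (ε * κ) (by have := hε.1; positivity) N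
  refine (ENNReal.rpow_le_rpow hle (by positivity)).trans ?_
  refine (ENNReal.rpow_le_rpow_of_exponent_le ?_ (inv_le_one_of_one_le₀ hr)).trans
    (ENNReal.rpow_one _).le
  rw [ENNReal.one_le_ofReal]
  exact le_max_left _ _

lemma le_grandNorm_stepFun_single (hp : 0 < p) (hθ : 0 < θ) {x m : ℝ} (hx : x⁻¹ ≤ p - 1)
    (hx0 : 0 < x) (hm : 0 ≤ m) {s : Set ℝ} (hs : MeasurableSet s)
    (hμ : ENNReal.ofReal (m * Real.exp (-x)) ≤ μ s) :
    ENNReal.ofReal (min 1 (m * Real.exp (-((θ + 1) / p))))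
      ≤ grandNorm p θ μ (s.indicator fun _ => (height p θ x : ℂ)) := by
  -- Test the supremum at `ε = 1/x`, admissible by `hx`. The minimum with `1` makes the later root
  -- only increase the lower bound.
  refine le_trans ?_ (le_grandNorm (ε := x⁻¹) ⟨inv_pos.2 hx0, hx⟩ _)
  have hr : 1 ≤ p - x⁻¹ := by linarith
  have hr0 : 0 < p - x⁻¹ := by linarith
  have hl : 0 < height p θ x := height_pos hx0
  rw [ofReal_rpow_mul_eLpNorm (inv_pos.2 hx0) hr0]
  have hint : ∫⁻ t, ‖s.indicator (fun _ => (height p θ x : ℂ)) t‖ₑ ^ (p - x⁻¹) ∂μ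
      = ENNReal.ofReal (height p θ x ^ (p - x⁻¹)) * μ s := by
    rw [← lintegral_indicator_const hs]
    refine lintegral_congr fun t => ?_
    by_cases ht : t ∈ s
    · rw [indicator_of_mem ht, indicator_of_mem ht, ← ofReal_norm, Complex.norm_real,
        Real.norm_of_nonneg hl.le, ENNReal.ofReal_rpow_of_nonneg hl.le hr0.le]
    · simp [ht, hr0]
  rw [hint]
  have hle : ENNReal.ofReal (min 1 (m * Real.exp (-((θ + 1) / p))))
      ≤ ENNReal.ofReal (x⁻¹ ^ θ) * (ENNReal.ofReal (height p θ x ^ (p - x⁻¹)) * μ s) := by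
    refine le_trans ?_ (mul_le_mul_right (mul_le_mul_right hμ _) _)
    rw [← ENNReal.ofReal_mul (by positivity), ← ENNReal.ofReal_mul (by positivity)]
    refine ENNReal.ofReal_le_ofReal ((min_le_right _ _).trans ?_)
    calc _ ≤ m * (x⁻¹ ^ θ * (height p θ x ^ (p - x⁻¹) * Real.exp (-x))) := by
          gcongr
          exact le_rpow_mul_height_rpow hp hθ hx0
      _ = _ := by ring
  refine le_trans ?_ (ENNReal.rpow_le_rpow hle (by positivity))
  refine (ENNReal.rpow_one _).symm.le.trans
    (ENNReal.rpow_le_rpow_of_exponent_ge ?_ (inv_le_one_of_one_le₀ hr))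
  exact ENNReal.ofReal_le_one.2 (min_le_left _ _)

end steps

/-! ### The blocks and their measures. -/

section blocks

/-- Disjoint intervals shrinking to `t₀` from the right. -/
def block (t₀ η κ : ℝ) (n : ℕ) : Set ℝ :=
  Ioc (t₀ + η * Real.exp (-(κ * 2 ^ (n + 1)))) (t₀ + η * Real.exp (-(κ * 2 ^ n)))

variable {t₀ η κ : ℝ}

lemma measurableSet_block (n : ℕ) : MeasurableSet (block t₀ η κ n) := measurableSet_Ioc

lemma pairwise_disjoint_block (hη : 0 < η) (hκ : 0 < κ) :
    Pairwise (Function.onFun Disjoint (block t₀ η κ)) := by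
  refine Antitone.pairwise_disjoint_on_Ioc_succ
    (f := fun n : ℕ => t₀ + η * Real.exp (-(κ * 2 ^ n))) fun m n h => ?_
  have : (2 : ℝ) ^ m ≤ 2 ^ n := pow_le_pow_right₀ (by norm_num) h
  have h2 : κ * 2 ^ m ≤ κ * 2 ^ n := by gcongr
  dsimp only
  gcongr

lemma block_subset_ball (hη : 0 < η) (hκ : 0 < κ) (n : ℕ) :
    block t₀ η κ n ⊆ Metric.ball t₀ η := by
  rintro t ⟨h1, h2⟩
  have h3 : 0 < η * Real.exp (-(κ * 2 ^ (n + 1))) := by positivity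
  have h4 : η * Real.exp (-(κ * 2 ^ n)) < η := by
    refine mul_lt_of_lt_one_right hη (Real.exp_lt_one_iff.2 ?_)
    have : 0 < κ * 2 ^ n := by positivity
    linarith
  rw [Metric.mem_ball, Real.dist_eq, abs_lt]
  constructor <;> linarith

/-- Doubling `κ 2^n` squares `e^(-κ 2^n)`, so the next endpoint costs only a factor `1 - e^(-κ
2^n)`, which lies between `1 - e^(-1)` and `1` once `κ ≥ 1`. -/
lemma volume_block (n : ℕ) :
    volume (block t₀ η κ n) = ENNReal.ofReal
      (η * (1 - Real.exp (-(κ * 2 ^ n))) * Real.exp (-(κ * 2 ^ n))) := by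
  rw [block, Real.volume_Ioc, pow_succ,
    show -(κ * (2 ^ n * 2)) = -(κ * 2 ^ n) + -(κ * 2 ^ n) by ring, Real.exp_add]
  ring_nf

lemma volume_block_le (hη : 0 < η) (n : ℕ) :
    volume (block t₀ η κ n) ≤ ENNReal.ofReal (η * Real.exp (-(κ * 2 ^ n))) := by
  rw [volume_block]
  have := Real.exp_pos (-(κ * 2 ^ n))
  gcongr
  exact mul_le_of_le_one_right hη.le (by linarith)

lemma le_volume_block (hη : 0 < η) (hκ : 1 ≤ κ) (n : ℕ) :
    ENNReal.ofReal (η * (1 - Real.exp (-1)) * Real.exp (-(κ * 2 ^ n)))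
      ≤ volume (block t₀ η κ n) := by
  rw [volume_block]
  have : 1 ≤ κ * 2 ^ n := one_le_mul_of_one_le_of_one_le hκ (one_le_pow₀ (by norm_num))
  gcongr

end blocks

/-! ### Embedding the steps and placing them under the window. -/

/-- A vector space of functions in the amalgam space, spanned by disjointly supported steps. -/
lemma exists_linearMap_stepFun {p θ₁ q θ₂ c d : ℝ} {Q : TopologicalSpace.Compacts ℝ}
    {A : ℕ → Set ℝ} {l : ℕ → ℝ} (hm : ∀ n, MeasurableSet (A n)) (hθ₂ : 0 < θ₂)
    (hfin : ∀ n, grandNorm p θ₁ (intervalMeasure c d) ((A n).indicator fun _ => (l n : ℂ)) ≠ ∞) :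
    ∃ T : (ℕ →₀ ℂ) →ₗ[ℂ] GrandAmalgam p θ₁ q θ₂ c d Q,
      ∀ b, ‖T b‖ = (amalgamNorm p θ₁ q θ₂ (intervalMeasure c d) Q (stepFun A l b)).toReal ∧
        amalgamNorm p θ₁ q θ₂ (intervalMeasure c d) Q (stepFun A l b) ≠ ∞ := by
  set μ := intervalMeasure c d with hμ
  have hmeas : ∀ n, AEStronglyMeasurable ((A n).indicator fun _ => (l n : ℂ)) μ := fun n =>
    (measurable_const.indicator (hm n)).aestronglyMeasurable
  have hmk := fun n => AEEqFun.coeFn_mk _ (hmeas n)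
  have hmem : ∀ n, AEEqFun.mk _ (hmeas n) ∈ amalgamSubmodule p θ₁ q θ₂ c d Q := fun n => by
    have hg : grandNorm p θ₁ μ (AEEqFun.mk _ (hmeas n) : ℝ →ₘ[μ] ℂ) < ∞ := by
      rw [grandNorm_congr_ae (hmk n)]
      exact (hfin n).lt_top
    refine ⟨fun K _ _ => lt_of_le_of_lt (grandNorm_mono fun t => ?_) hg, ?_⟩
    · by_cases ht : t ∈ K <;> simp [ht]
    · exact (amalgamNorm_le hg.ne).trans_lt (ENNReal.mul_lt_top hg (grandNorm_one_lt_top hθ₂))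
  let f : ℕ → GrandAmalgam p θ₁ q θ₂ c d Q := fun n => ⟨_, hmem n⟩
  have hT : ∀ b, ((Finsupp.linearCombination ℂ f b).1 : ℝ → ℂ) =ᵐ[μ] stepFun A l b := fun b => by
    induction b using Finsupp.induction_linear with
    | zero =>
      rw [map_zero]
      have h0 := AEEqFun.coeFn_zero (α := ℝ) (β := ℂ) (μ := μ)
      refine h0.trans (Eventually.of_forall fun t => ?_)
      simp [stepFun]
    | add b b' hb hb' =>
      rw [map_add, stepFun_add]
      exact (AEEqFun.coeFn_add _ _).trans (hb.add hb')
    | single n z =>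
      rw [Finsupp.linearCombination_single, stepFun_single]
      exact (AEEqFun.coeFn_smul z (AEEqFun.mk _ (hmeas n))).trans ((hmk n).const_smul z)
  refine ⟨Finsupp.linearCombination ℂ f, fun b => ⟨?_, ?_⟩⟩
  · rw [← amalgamNorm_congr_ae (hT b)]
    rfl
  · rw [← amalgamNorm_congr_ae (hT b)]
    exact (Finsupp.linearCombination ℂ f b).2.2.ne

lemma exists_ball_subset_translate {c d : ℝ} {Q : TopologicalSpace.Compacts ℝ}
    (hQ : ∃ x ∈ Ioo c d, (interior (translate Q x) ∩ Ioo c d).Nonempty) :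
    ∃ x₀ t₀ η, 0 < η ∧ Metric.ball x₀ η ⊆ Ioo c d ∧ Metric.ball t₀ η ⊆ Ioo c d ∧
      ∀ x ∈ Metric.ball x₀ η, Metric.ball t₀ η ⊆ translate Q x := by
  obtain ⟨x₀, hx₀, t₀, ht₀, ht₀'⟩ := hQ
  obtain ⟨η₁, h1, hη₁⟩ := Metric.isOpen_iff.1 isOpen_Ioo x₀ hx₀
  obtain ⟨η₂, h2, hη₂⟩ := Metric.isOpen_iff.1 isOpen_Ioo t₀ ht₀'
  obtain ⟨η₃, h3, hη₃⟩ := Metric.isOpen_iff.1 isOpen_interior t₀ ht₀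
  -- Half of `η₃`, because moving `x` and `t` together shifts `t - x` by up to twice the radius.
  refine ⟨x₀, t₀, min η₁ (min η₂ (η₃ / 2)), by positivity,
    (Metric.ball_subset_ball (min_le_left _ _)).trans hη₁,
    (Metric.ball_subset_ball ((min_le_right _ _).trans (min_le_left _ _))).trans hη₂,
    fun x hx t ht => ?_⟩
  have hle : min η₁ (min η₂ (η₃ / 2)) ≤ η₃ / 2 := (min_le_right _ _).trans (min_le_right _ _)
  rw [Metric.mem_ball, Real.dist_eq] at hx ht
  have hmem : t - x + x₀ ∈ translate Q x₀ := by
    refine interior_subset (hη₃ ?_)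
    rw [Metric.mem_ball, Real.dist_eq,
      show t - x + x₀ - t₀ = (t - t₀) - (x - x₀) by ring]
    exact (abs_sub _ _).trans_lt (by linarith)
  rw [mem_translate] at hmem ⊢
  simpa using hmem

end GrandWiener

/-! ### The copy of `c₀` in the amalgam space. -/

open GrandWiener

theorem mainTheorem3 (p q θ c d : ℝ) (hp : 1 < p) (hq : 1 < q) (hθ : 0 < θ) (hcd : c < d)
    (Q : TopologicalSpace.Compacts ℝ)
    (hQ : ∃ x ∈ Set.Ioo c d, (interior (GrandWiener.translate Q x) ∩ Set.Ioo c d).Nonempty) :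
    ¬ GrandWiener.IsReflexive (GrandWiener.GrandAmalgam p θ q θ c d Q) := by
  obtain ⟨x₀, t₀, η, hη, hx₀, ht₀, htr⟩ := exists_ball_subset_translate hQ
  set μ := intervalMeasure c d with hμ
  have hp0 : 0 < p := by linarith
  have hp1 : 0 < p - 1 := by linarith
  -- This makes `κ ≥ 1` and every `1 / (κ 2^n)` at most `p - 1`, so all test values of `ε` are
  -- admissible.
  set κ : ℝ := p / (p - 1) with hκdef
  have hκ : 1 ≤ κ := by rw [hκdef, one_le_div hp1]; linarith
  have hκ0 : 0 < κ := by linarith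
  set A := block t₀ η κ with hA
  set l : ℕ → ℝ := fun n => height p θ (κ * 2 ^ n) with hl
  have hdisj : Pairwise (Function.onFun Disjoint A) := pairwise_disjoint_block hη hκ0
  have hAm : ∀ n, MeasurableSet (A n) := fun n => measurableSet_block n
  have hAball : ∀ n, A n ⊆ Metric.ball t₀ η := fun n => block_subset_ball hη hκ0 n
  have hμA : ∀ n, μ (A n) = volume (A n) := fun n =>
    Measure.restrict_eq_self _ ((hAball n).trans ht₀)
  obtain ⟨K, hK, hup⟩ := grandNorm_stepFun_unitSum_le (μ := μ) hp0 hθ hκ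
  replace hup := hup A hdisj hAm η hη fun n => (hμA n).trans_le (volume_block_le hη n)
  -- Block `n` is dominated by the partial sum of length `n + 1`, the first to include it.
  have hfin : ∀ n, grandNorm p θ μ ((A n).indicator fun _ => (l n : ℂ)) ≠ ∞ := fun n => by
    refine ((grandNorm_mono fun t => ?_).trans (hup (n + 1))).trans_lt ENNReal.ofReal_lt_top |>.ne
    have := enorm_stepFun_single_le (l := l) hdisj (unitSum (n + 1)) n t
    rwa [unitSum_apply, if_pos n.lt_succ_self, stepFun_single, one_smul] at this
  obtain ⟨T, hT⟩ := exists_linearMap_stepFun (p := p) (θ₁ := θ) (q := q) (Q := Q) hAm hθ hfin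
  set a₁ : ℝ := min 1 (η * (1 - Real.exp (-1)) * Real.exp (-((θ + 1) / p))) with ha₁
  have he : 0 < 1 - Real.exp (-1) := by
    have : Real.exp (-1) < 1 := Real.exp_lt_one_iff.2 (by norm_num)
    linarith
  have ha₁0 : 0 < a₁ := by positivity
  have hsingle : ∀ n, ENNReal.ofReal a₁ ≤ grandNorm p θ μ ((A n).indicator fun _ => (l n : ℂ)) :=
    fun n => by
    have h2 : (1 : ℝ) ≤ 2 ^ n := one_le_pow₀ (by norm_num)
    refine le_grandNorm_stepFun_single hp0 hθ ?_ (by positivity) (by positivity) (hAm n)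
      ((le_volume_block hη hκ n).trans_eq (hμA n).symm)
    calc (κ * 2 ^ n)⁻¹ ≤ κ⁻¹ := inv_anti₀ hκ0 (le_mul_of_one_le_right hκ0.le h2)
      _ = (p - 1) / p := by rw [hκdef, inv_div]
      _ ≤ p - 1 := div_le_self hp1.le hp.le
  have hμB : μ (Metric.ball x₀ η) = ENNReal.ofReal (2 * η) := by
    rw [hμ, intervalMeasure, Measure.restrict_eq_self _ hx₀, Real.volume_ball]
  -- The factors of `a` are the weight at `ε = q - 1`, the length of the ball about `x₀`, and the
  -- lower bound for one block.
  refine not_isReflexive_of_finsupp T (a := (q - 1) ^ θ * (2 * η) * a₁)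
    (C := (ENNReal.ofReal (max 1 (η * K)) *
      grandNorm q θ μ (fun _ : ℝ => (1 : ℝ≥0∞))).toReal) ?_ (fun b n => ?_) fun N => ?_
  · have : 0 < q - 1 := by linarith
    positivity
  · have hq0 : 0 ≤ (q - 1) ^ θ := Real.rpow_nonneg (by linarith) _
    rw [(hT b).1, ← ENNReal.ofReal_le_iff_le_toReal (hT b).2,
      ENNReal.ofReal_mul (by positivity), ENNReal.ofReal_mul (by positivity),
      ENNReal.ofReal_mul hq0, mul_assoc, ← hμB, ofReal_norm]
    refine le_trans ?_ (le_amalgamNorm (θ₁ := θ) (p := p) (B := Metric.ball x₀ η) hq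
      Metric.isOpen_ball.measurableSet fun x hx t ht =>
        stepFun_of_notMem (fun n hn => ht (htr x hx (hAball n hn))) b)
    gcongr
    calc ENNReal.ofReal a₁ * ‖b n‖ₑ
        ≤ grandNorm p θ μ (stepFun A l (Finsupp.single n (b n))) := by
          rw [stepFun_single, grandNorm_smul, mul_comm]
          gcongr
          exact hsingle n
      _ ≤ _ := grandNorm_mono (enorm_stepFun_single_le hdisj b n)
  · rw [(hT _).1]
    have hg := hup N
    refine ENNReal.toReal_mono (ENNReal.mul_ne_top ENNReal.ofReal_ne_top
      (grandNorm_one_lt_top hθ).ne) ?_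
    exact (amalgamNorm_le (hg.trans_lt ENNReal.ofReal_lt_top).ne).trans (by gcongr)
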